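/- Let $n\ge 2$, let $\Omega\subset\mathbb{R}^n$ be a bounded open set with Lipschitz boundary, and put $1^*:=\frac{n}{n-1}$. Let $BD(\Omega)$ be the space of all $u\in L^1(\Omega;\mathbb{R}^n)$ whose distributional symmetrised gradient $\mathrm{E}u$, with components $\mathrm{E}_{ij}u=\frac12(D_ju^i+D_iu^j)$, is a bounded Radon measure on $\Omega$ with values in the symmetric $n\times n$ matrices. Say that $u_k\stackrel{*}{\rightharpoonup}u$ weakly* in $BD(\Omega)$ if $u_k\to u$ strongly in $L^1(\Omega;\mathbb{R}^n)$ and $\mathrm{E}u_k\stackrel{*}{\rightharpoonup}\mathrm{E}u$ weakly* as bounded measures, i.e. in duality with the space $C_0(\Omega)$ of continuous functions on $\overline\Omega$ vanishing on $\partial\Omega$. Let $(u_k)_k$ be a sequence in $BD(\Omega)$ such that $u_k\stackrel{*}{\rightharpoonup}0$ weakly* in $BD(\Omega)$, and suppose that for some non-negative bounded Radon measure $\nu$ on $\Omega$ $$|u_k|^{1^*}\stackrel{*}{\rightharpoonup}\nu\quad\text{weakly* as bounded measures on }\Omega,$$ i.e. $\int_\Omega f\,|u_k|^{1^*}\,dx\to\int_\Omega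 f\,d\nu$ for every $f\in C_0(\Omega)$. Then $\nu$ is concentrated on an at most countable set: there exist an at most countable (possibly empty) set $\{x_j\}_j$ of points of $\Omega$ and numbers $c_j\in(0,+\infty)$ such that $$\nu=\sum_j c_j\,\delta_{x_j}.$$ -/

import Mathlib

open MeasureTheory Filter Topology TopologicalSpace
open scoped ZeroAtInfty Distributions VectorMeasure NNReal

/-- The set `Ω` has Lipschitz boundary: near each of its boundary points it is, for a suitable
unit vector `v`, the set of points lying strictly below the graph, in the direction `v`, of a
Lipschitz function defined on the hyperplane orthogonal to `v`. -/
def HasLipschitzBoundary {n : ℕ} (Ω : Set (EuclideanSpace ℝ (Fin n))) : Prop :=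
  ∀ x₀ ∈ frontier Ω, ∃ v : EuclideanSpace ℝ (Fin n), ‖v‖ = 1 ∧
    ∃ (K : ℝ≥0) (γ : (Submodule.span ℝ {v})ᗮ → ℝ), LipschitzWith K γ ∧
      ∀ᶠ x in 𝓝 x₀, x ∈ Ω ↔ inner ℝ v x < γ ((Submodule.span ℝ {v})ᗮ.orthogonalProjectionOnto x)

/-- Lebesgue measure on the open set `Ω`. -/
noncomputable abbrev lebesgueOn {n : ℕ} (Ω : Opens (EuclideanSpace ℝ (Fin n))) : Measure Ω :=
  Measure.comap Subtype.val volume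

/-- The matrix `σ` of finite signed Borel measures on `Ω` is the symmetrised gradient `Eu`, in the
sense of distributions on `Ω`, of the integrable vector field `u`, that is
`σ i j = (D_j u_i + D_i u_j) / 2`. -/
def IsSymGradient {n : ℕ} {Ω : Opens (EuclideanSpace ℝ (Fin n))}
    (u : Ω →₁[lebesgueOn Ω] EuclideanSpace ℝ (Fin n))
    (σ : Matrix (Fin n) (Fin n) (SignedMeasure Ω)) : Prop :=
  ∀ (i j : Fin n) (φ : 𝓓(Ω, ℝ)),
    ∫ᵛ x : Ω, φ x ∂<•(σ i j) =
      -∫ x : Ω, (u x i * fderiv ℝ φ (x : EuclideanSpace ℝ (Fin n)) (EuclideanSpace.single j 1)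
        + u x j * fderiv ℝ φ (x : EuclideanSpace ℝ (Fin n)) (EuclideanSpace.single i 1)) / 2
        ∂(lebesgueOn Ω)

/-- The space `BD(Ω)` of functions of bounded deformation, as a subset of `L¹(Ω; ℝⁿ)`. -/
def BD {n : ℕ} (Ω : Opens (EuclideanSpace ℝ (Fin n))) :
    Set (Ω →₁[lebesgueOn Ω] EuclideanSpace ℝ (Fin n)) :=
  {u | ∃ σ : Matrix (Fin n) (Fin n) (SignedMeasure Ω), IsSymGradient u σ}

/-- The symmetrised gradient `Eu` of `u ∈ BD(Ω)`; it is uniquely determined by `u`, because a finite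
signed Borel measure on `Ω` is determined by its values on test functions. -/
noncomputable def BD.symGradient {n : ℕ} {Ω : Opens (EuclideanSpace ℝ (Fin n))} (u : BD Ω) :
    Matrix (Fin n) (Fin n) (SignedMeasure Ω) :=
  u.2.choose

/-- Weak* convergence `u_k ⇀* u` in `BD(Ω)`: strong convergence in `L¹(Ω; ℝⁿ)`, and weak*
convergence (in duality with `C₀(Ω)`, in each component) of the measures `Eu_k` to `Eu`. -/
def BD.WeakStarTendsto {n : ℕ} {Ω : Opens (EuclideanSpace ℝ (Fin n))}
    (u : ℕ → BD Ω) (u' : BD Ω) : Prop :=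
  Tendsto (fun k => (u k : Ω →₁[lebesgueOn Ω] EuclideanSpace ℝ (Fin n))) atTop (𝓝 u') ∧
  ∀ (i j : Fin n) (f : C₀(Ω, ℝ)),
    Tendsto (fun k => ∫ᵛ x, f x ∂<•(BD.symGradient (u k) i j)) atTop
      (𝓝 (∫ᵛ x, f x ∂<•(BD.symGradient u' i j)))

/-- The zero vector field has bounded deformation. -/
theorem BD.zero_mem {n : ℕ} (Ω : Opens (EuclideanSpace ℝ (Fin n))) :
    (0 : Ω →₁[lebesgueOn Ω] EuclideanSpace ℝ (Fin n)) ∈ BD Ω := by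
  refine ⟨0, fun i j φ => ?_⟩
  have h : (fun x : Ω => ((0 : Ω →₁[lebesgueOn Ω] EuclideanSpace ℝ (Fin n)) x i *
      fderiv ℝ φ (x : EuclideanSpace ℝ (Fin n)) (EuclideanSpace.single j 1)
        + (0 : Ω →₁[lebesgueOn Ω] EuclideanSpace ℝ (Fin n)) x j *
      fderiv ℝ φ (x : EuclideanSpace ℝ (Fin n)) (EuclideanSpace.single i 1)) / 2)
      =ᵐ[lebesgueOn Ω] 0 := by
    filter_upwards [Lp.coeFn_zero (EuclideanSpace ℝ (Fin n)) 1 (lebesgueOn Ω)] with x hx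
    simp only [hx]
    simp
  rw [integral_congr_ae h]
  simp

/-! The analytic input is Strauss' inequality `‖w‖_p ≤ C |Ew|`, `p = n/(n-1)`, for compactly
supported fields. It is applied to `φ_m u_k`, where the cutoffs `φ_m` have pairwise product zero and
equal 1 on given disjoint compact sets `K_m`. The mass of `E(φ_m u_k)` is controlled by `Eu_k`
localised by `φ_m`, plus `sup |∇φ_m| ‖u_k‖₁`. Summed over `m`, the first terms stay below a bound
uniform in `k` (Banach–Steinhaus), and the second vanish as `k → ∞`. Hence `∑ ν(K_m)^(1/p) ≤ M` with
`M` independent of the family (`exists_sum_rpow_measure_le`).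

Since `1/p < 1`, such a bound excludes a diffuse part: the set of non-atoms splits into pieces of
measure at most `ε`, each satisfying `ν(A) ≤ ε^(1-1/p) ν(A)^(1/p)`, so its measure is at most
`ε^(1-1/p) M` (`measure_setOf_singleton_eq_zero_of_sum_rpow_le`).

Strauss' inequality itself uses only the derivatives `∂_e ⟨e, w⟩`, which are entries of `Ew`. In an
orthonormal basis they bound `∏ |⟨b_i, w⟩|^(1/(n-1))` in `L¹` as in the Gagliardo–Nirenberg proof,
and finitely many bases suffice to dominate `|w|^p` (`exists_norm_rpow_le_sum_prod_inner`). -/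

open scoped ContDiff ENNReal

/-! ### Strauss' inequality for smooth fields. -/

section Strauss

variable {ι V : Type*} [Fintype ι] [NormedAddCommGroup V] [InnerProductSpace ℝ V]

theorem enorm_le_lintegral_fderiv_along_line {g : V → ℝ} (hg : ContDiff ℝ 1 g)
    (hgc : HasCompactSupport g) (b : OrthonormalBasis ι ℝ V) [DecidableEq ι] (i : ι) (y : ι → ℝ) :
    ‖g (b.repr.symm (WithLp.toLp 2 y))‖ₑ ≤
      ∫⁻ t : ℝ, ‖fderiv ℝ g (b.repr.symm (WithLp.toLp 2 (Function.update y i t))) (b i)‖ₑ := by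
  set γ : ℝ → V := fun t => b.repr.symm (WithLp.toLp 2 (Function.update y i t)) with hγ
  have hγ' : ∀ t, γ t = γ 0 + t • b i := by
    intro t
    apply b.repr.injective
    ext j
    by_cases h : j = i
    · subst h; simp [hγ]
    · simp [hγ, h]
  have hcd : ContDiff ℝ 1 γ := by
    have : γ = fun t => γ 0 + t • b i := funext hγ'
    rw [this]; fun_prop
  have hder : ∀ t, HasDerivAt γ (b i) t := by
    intro t
    have : γ = fun t => γ 0 + t • b i := funext hγ'
    rw [this]
    simpa using ((hasDerivAt_id t).smul_const (b i)).const_add (γ 0)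
  have hemb : IsClosedEmbedding γ :=
    (b.repr.symm.toHomeomorph.isClosedEmbedding.comp
      ((PiLp.homeomorph 2 (fun _ : ι => ℝ)).symm.isClosedEmbedding)).comp
      (isClosedEmbedding_update y i)
  have hsupp : HasCompactSupport (g ∘ γ) := hgc.comp_isClosedEmbedding hemb
  calc ‖g (b.repr.symm (WithLp.toLp 2 y))‖ₑ = ‖(g ∘ γ) (y i)‖ₑ := by simp [hγ]
    _ ≤ ∫⁻ t in Set.Iic (y i), ‖deriv (g ∘ γ) t‖ₑ :=
        HasCompactSupport.enorm_le_lintegral_Ici_deriv (hg.comp hcd) hsupp _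
    _ ≤ ∫⁻ t, ‖deriv (g ∘ γ) t‖ₑ := lintegral_mono' Measure.restrict_le_self le_rfl
    _ = _ := by
        refine lintegral_congr fun t => ?_
        rw [((hg.differentiable one_ne_zero (γ t)).hasFDerivAt.comp_hasDerivAt t (hder t)).deriv]

/-- The diagonal vector `∑ b₀ i` has all coordinates equal to 1; a reflection carries a multiple of
it to `z`, and carries the basis along. -/
theorem OrthonormalBasis.exists_forall_inner_ne_zero [Nonempty ι] (b₀ : OrthonormalBasis ι ℝ V)
    {z : V} (hz : z ≠ 0) : ∃ b : OrthonormalBasis ι ℝ V, ∀ i, inner ℝ (b i) z ≠ 0 := by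
  set s : V := ∑ i, b₀ i with hs
  have hsi : ∀ i, inner ℝ (b₀ i) s = 1 := fun i => by
    classical
    rw [hs, inner_sum]
    simp [OrthonormalBasis.inner_eq_ite]
  have hs0 : s ≠ 0 := by
    intro h
    have := hsi (Classical.arbitrary ι)
    simp [h] at this
  set c : ℝ := ‖z‖ / ‖s‖ with hc
  have hc0 : 0 < c := div_pos (norm_pos_iff.2 hz) (norm_pos_iff.2 hs0)
  have hn : ‖c • s‖ = ‖z‖ := by
    rw [norm_smul, Real.norm_of_nonneg hc0.le, hc, div_mul_cancel₀ _ (norm_ne_zero_iff.2 hs0)]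
  obtain ⟨R, hR⟩ : ∃ R : V ≃ₗᵢ[ℝ] V, R (c • s) = z := ⟨_, Submodule.reflection_sub hn⟩
  refine ⟨b₀.map R, fun i => ?_⟩
  rw [OrthonormalBasis.map_apply, ← hR, LinearIsometryEquiv.inner_map_map, inner_smul_right, hsi]
  simpa using hc0.ne'

/-- For one basis the product vanishes on the coordinate hyperplanes. Each point of the unit sphere
has a basis whose product is positive nearby, so by compactness finitely many have a sum bounded
below there; both sides are homogeneous of degree `p`. -/
theorem exists_norm_rpow_le_sum_prod_inner [FiniteDimensional ℝ V]
    (b₀ : OrthonormalBasis ι ℝ V) {p : ℝ}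
    (hp : Real.HolderConjugate (Fintype.card ι) p) :
    ∃ (S : Finset (OrthonormalBasis ι ℝ V)) (C : ℝ≥0), ∀ z : V,
      ‖z‖ₑ ^ p ≤ C * ∑ b ∈ S,
        ∏ i, ‖inner ℝ (b i) z‖ₑ ^ ((1 : ℝ) / (Fintype.card ι - 1 : ℝ)) := by
  have hcard : (1 : ℝ) < Fintype.card ι := hp.lt
  have hne : Nonempty ι := Fintype.card_pos_iff.1 (by exact_mod_cast zero_lt_one.trans hcard)
  set q : ℝ := (1 : ℝ) / (Fintype.card ι - 1 : ℝ) with hq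
  have hq0 : 0 < q := div_pos one_pos (by linarith)
  have hqp : q * Fintype.card ι = p := by
    rw [hp.conjugate_eq, hq]; ring
  set F : OrthonormalBasis ι ℝ V → V → ℝ := fun b z => ∏ i, |inner ℝ (b i) z| ^ q with hF
  have hFc : ∀ b, Continuous (F b) := fun b =>
    continuous_finsetProd _ fun i _ =>
      ((continuous_const.inner continuous_id).abs).rpow_const fun _ => Or.inr hq0.le
  have hF0 : ∀ b z, 0 ≤ F b z := fun b z =>
    Finset.prod_nonneg fun i _ => Real.rpow_nonneg (abs_nonneg _) _
  obtain ⟨S, hS⟩ := (isCompact_sphere (0 : V) 1).elim_finite_subcover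
    (fun b : OrthonormalBasis ι ℝ V => {z | 0 < F b z})
    (fun b => isOpen_lt continuous_const (hFc b)) (by
      intro z hz
      have hz0 : z ≠ 0 := by rintro rfl; simp at hz
      obtain ⟨b, hb⟩ := b₀.exists_forall_inner_ne_zero hz0
      exact Set.mem_iUnion.2 ⟨b, Finset.prod_pos fun i _ =>
        Real.rpow_pos_of_pos (abs_pos.2 (hb i)) _⟩)
  have hGpos : ∀ z ∈ Metric.sphere (0 : V) 1, 0 < ∑ b ∈ S, F b z := by
    intro z hz
    obtain ⟨b, hbS, hb⟩ := Set.mem_iUnion₂.1 (hS hz)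
    exact Finset.sum_pos' (fun b _ => hF0 b z) ⟨b, hbS, hb⟩
  obtain ⟨m, hm, hmle⟩ : ∃ m : ℝ, 0 < m ∧ ∀ z ∈ Metric.sphere (0 : V) 1, m ≤ ∑ b ∈ S, F b z :=
    (isCompact_sphere (0 : V) 1).exists_forall_le'
      (continuous_finsetSum S fun b _ => hFc b).continuousOn hGpos
  have hreal : ∀ z : V, ‖z‖ ^ p ≤ m⁻¹ * ∑ b ∈ S, F b z := by
    intro z
    by_cases hz : z = 0
    · subst hz
      rw [norm_zero, Real.zero_rpow hp.symm.ne_zero]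
      exact mul_nonneg (inv_nonneg.2 hm.le) (Finset.sum_nonneg fun b _ => hF0 b _)
    have hz0 : 0 < ‖z‖ := norm_pos_iff.2 hz
    set z' : V := ‖z‖⁻¹ • z with hz'
    have h1 : z' ∈ Metric.sphere (0 : V) 1 := by
      rw [mem_sphere_zero_iff_norm, hz', norm_smul, norm_inv, norm_norm, inv_mul_cancel₀ hz0.ne']
    have h2 : ∀ b, F b z = ‖z‖ ^ p * F b z' := by
      intro b
      have hzz : z = ‖z‖ • z' := by rw [hz', smul_smul, mul_inv_cancel₀ hz0.ne', one_smul]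
      have h3 : ∀ i, |inner ℝ (b i) z| ^ q = ‖z‖ ^ q * |inner ℝ (b i) z'| ^ q := by
        intro i
        rw [← Real.mul_rpow hz0.le (abs_nonneg _)]
        conv_lhs => rw [hzz, inner_smul_right, abs_mul, abs_norm]
      simp only [hF, h3, Finset.prod_mul_distrib, Finset.prod_const, Finset.card_univ]
      rw [← Real.rpow_natCast, ← Real.rpow_mul hz0.le, hqp]
    simp only [h2, ← Finset.mul_sum]
    have h4 := hmle z' h1
    have h5 : 0 < ‖z‖ ^ p := Real.rpow_pos_of_pos hz0 p
    rw [mul_left_comm]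
    refine le_mul_of_one_le_right h5.le ?_
    rw [inv_mul_eq_div, one_le_div hm]
    exact h4
  refine ⟨S, m⁻¹.toNNReal, fun z => ?_⟩
  have h6 := ENNReal.ofReal_le_ofReal (hreal z)
  rw [ENNReal.ofReal_mul (inv_nonneg.2 hm.le), ENNReal.ofReal_sum_of_nonneg (fun b _ => hF0 b z),
    ← ENNReal.ofReal_rpow_of_nonneg (norm_nonneg z) hp.symm.nonneg, ofReal_norm] at h6
  refine h6.trans (le_of_eq ?_)
  congr 1
  refine Finset.sum_congr rfl fun b _ => ?_
  rw [ENNReal.ofReal_prod_of_nonneg fun i _ => Real.rpow_nonneg (abs_nonneg _) _]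
  refine Finset.prod_congr rfl fun i _ => ?_
  rw [← ENNReal.ofReal_rpow_of_nonneg (abs_nonneg _) hq0.le, ← Real.enorm_eq_ofReal_abs]

variable [FiniteDimensional ℝ V] [MeasurableSpace V] [BorelSpace V]

/-- The field `w` has symmetrised gradient of mass at most `A`, tested weakly on the quadratic
forms `e ⊗ e`. -/
def HasSymDerivBound (w : V → V) (A : ℝ) : Prop :=
  ∀ e : V, ‖e‖ = 1 → ∀ ψ : V → ℝ, ContDiff ℝ ∞ ψ → HasCompactSupport ψ → (∀ x, |ψ x| ≤ 1) →
    |∫ x, inner ℝ e (w x) * fderiv ℝ ψ x e| ≤ A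

/-- Each component `⟨b i, w⟩` is bounded by the integral of its derivative along the line in its own
direction `b i`; the grid-lines inequality then handles the product. That inequality takes a single
integrand, hence the sum over `i` on the right. -/
theorem lintegral_prod_inner_le {w : V → V} (hw : ContDiff ℝ 1 w) (hwc : HasCompactSupport w)
    (b : OrthonormalBasis ι ℝ V) {p : ℝ} (hp : Real.HolderConjugate (Fintype.card ι) p) :
    ∫⁻ x, ∏ i, ‖inner ℝ (b i) (w x)‖ₑ ^ ((1 : ℝ) / (Fintype.card ι - 1 : ℝ)) ≤
      (∫⁻ x, ∑ i, ‖fderiv ℝ (fun y => inner ℝ (b i) (w y)) x (b i)‖ₑ) ^ p := by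
  classical
  have hg : ∀ i, ContDiff ℝ 1 (fun y => inner ℝ (b i) (w y)) := fun i => contDiff_const.inner ℝ hw
  have hgc : ∀ i, HasCompactSupport (fun y => inner ℝ (b i) (w y)) := fun i =>
    hwc.comp_left (g := fun z => inner ℝ (b i) z) (inner_zero_right _)
  have hmp : MeasurePreserving (fun y : ι → ℝ => b.repr.symm (WithLp.toLp 2 y)) :=
    b.measurePreserving_repr_symm.comp (PiLp.volume_preserving_toLp ι)
  have hcontd : ∀ i, Continuous
      (fun x => fderiv ℝ (fun y => inner ℝ (b i) (w y)) x (b i)) := fun i =>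
    ((hg i).continuous_fderiv one_ne_zero).clm_apply continuous_const
  have hmeas : Measurable
      (fun x => ∑ i, ‖fderiv ℝ (fun y => inner ℝ (b i) (w y)) x (b i)‖ₑ) :=
    Finset.measurable_fun_sum _ fun i _ => (hcontd i).measurable.enorm
  have hmeas' : Measurable
      (fun x => ∏ i, ‖inner ℝ (b i) (w x)‖ₑ ^ ((1 : ℝ) / (Fintype.card ι - 1 : ℝ))) :=
    Finset.measurable_fun_prod _ fun i _ => (hg i).continuous.measurable.enorm.pow_const _
  have hc : (0 : ℝ) ≤ (1 : ℝ) / (Fintype.card ι - 1 : ℝ) := by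
    have := hp.lt
    exact div_nonneg zero_le_one (by linarith)
  rw [← hmp.lintegral_comp hmeas, ← hmp.lintegral_comp hmeas']
  refine le_trans (lintegral_mono fun y => ?_)
    (lintegral_prod_lintegral_pow_le (fun _ : ι => (volume : Measure ℝ)) hp
      (hmeas.comp hmp.measurable))
  refine Finset.prod_le_prod' fun i _ => ?_
  refine ENNReal.rpow_le_rpow ?_ hc
  refine (enorm_le_lintegral_fderiv_along_line (hg i) (hgc i) b i y).trans
    (lintegral_mono fun t => ?_)
  exact Finset.single_le_sum (f := fun i => ‖fderiv ℝ (fun y => inner ℝ (b i) (w y))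
    (b.repr.symm (WithLp.toLp 2 (Function.update y _ t))) (b i)‖ₑ) (fun _ _ => zero_le)
    (Finset.mem_univ i)

/-- Duality: after integrating by parts, test with a smoothed sign of the derivative. -/
theorem lintegral_fderiv_le_of_forall_integral_le {g : V → ℝ} (hg : ContDiff ℝ ∞ g)
    (hgc : HasCompactSupport g) (e : V) {A : ℝ}
    (h : ∀ ψ : V → ℝ, ContDiff ℝ ∞ ψ → HasCompactSupport ψ → (∀ x, |ψ x| ≤ 1) →
      |∫ x, g x * fderiv ℝ ψ x e| ≤ A) :
    ∫⁻ x, ‖fderiv ℝ g x e‖ₑ ≤ ENNReal.ofReal A := by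
  set f : V → ℝ := fun x => fderiv ℝ g x e with hf
  have hfs : ContDiff ℝ ∞ f := (hg.fderiv_right (by simp)).clm_apply contDiff_const
  have hfc : HasCompactSupport f := hgc.fderiv_apply ℝ e
  have hfi : Integrable f := hfs.continuous.integrable_of_hasCompactSupport hfc
  have key : ∀ δ : ℝ, 0 < δ → ∫ x, |f x| ≤ A + δ * volume.real (tsupport f) := by
    intro δ hδ
    -- This regularised sign is smooth, bounded by 1, supported where `f` is, and loses at most `δ`
    -- pointwise: `f ψ ≥ |f| - δ`.
    set ψ : V → ℝ := fun x => f x / √(f x ^ 2 + δ ^ 2) with hψ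
    have hpos : ∀ x, 0 < f x ^ 2 + δ ^ 2 := fun x => by positivity
    have hsq : ∀ x, |f x| ≤ √(f x ^ 2 + δ ^ 2) := fun x =>
      Real.abs_le_sqrt (by nlinarith [sq_nonneg δ])
    have hψs : ContDiff ℝ ∞ ψ :=
      hfs.div (((hfs.pow 2).add contDiff_const).sqrt fun x => (hpos x).ne')
        fun x => (Real.sqrt_pos.2 (hpos x)).ne'
    have hψc : HasCompactSupport ψ := by
      have : ψ = fun x => f x * (√(f x ^ 2 + δ ^ 2))⁻¹ := by ext x; simp [hψ, div_eq_mul_inv]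
      rw [this]; exact hfc.mul_right
    have hψ1 : ∀ x, |ψ x| ≤ 1 := fun x => by
      rw [hψ, abs_div, abs_of_nonneg (Real.sqrt_nonneg _)]
      exact div_le_one_of_le₀ (hsq x) (Real.sqrt_nonneg _)
    have hb := h ψ hψs hψc hψ1
    have hgψ : ContDiff ℝ ∞ (fun x => fderiv ℝ ψ x e) :=
      (hψs.fderiv_right (by simp)).clm_apply contDiff_const
    rw [integral_mul_fderiv_eq_neg_fderiv_mul_of_integrable
      ((hfs.continuous.mul hψs.continuous).integrable_of_hasCompactSupport hfc.mul_right)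
      ((hg.continuous.mul hgψ.continuous).integrable_of_hasCompactSupport hgc.mul_right)
      ((hg.continuous.mul hψs.continuous).integrable_of_hasCompactSupport hgc.mul_right)
      (fun x _ => hg.differentiable (by simp) x) (fun x _ => hψs.differentiable (by simp) x),
      abs_neg] at hb
    have hlow : ∀ x, |f x| - (tsupport f).indicator (fun _ => δ) x ≤ f x * ψ x := by
      intro x
      by_cases hx : x ∈ tsupport f
      · rw [Set.indicator_of_mem hx]
        have hs := Real.sqrt_pos.2 (hpos x)
        have h1 : √(f x ^ 2 + δ ^ 2) ≤ |f x| + δ := by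
          rw [Real.sqrt_le_left (by positivity)]
          nlinarith [abs_nonneg (f x), sq_abs (f x)]
        have : f x * ψ x = |f x| ^ 2 / √(f x ^ 2 + δ ^ 2) := by
          simp only [hψ, sq_abs]; ring
        rw [this, le_div_iff₀ hs]
        by_cases hd : |f x| ≤ δ
        · nlinarith [sq_nonneg (f x), sq_abs (f x)]
        · push Not at hd
          nlinarith [sq_nonneg δ, sq_abs (f x)]
      · simp [image_eq_zero_of_notMem_tsupport hx, Set.indicator_of_notMem hx]
    have hind : Integrable ((tsupport f).indicator fun _ : V => δ) :=
      (integrable_indicator_iff (isClosed_tsupport f).measurableSet).2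
        (integrableOn_const hfc.isCompact.measure_lt_top.ne)
    have h2 : ∫ x, (|f x| - (tsupport f).indicator (fun _ => δ) x) ≤ ∫ x, f x * ψ x :=
      integral_mono (hfi.abs.sub hind)
        ((hfs.continuous.mul hψs.continuous).integrable_of_hasCompactSupport hfc.mul_right) hlow
    rw [integral_sub hfi.abs hind, integral_indicator (isClosed_tsupport f).measurableSet,
      setIntegral_const, smul_eq_mul] at h2
    have := le_abs_self (∫ x, f x * ψ x)
    linarith
  have hA : ∫ x, |f x| ≤ A := by
    refine le_of_forall_pos_le_add fun ε hε => ?_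
    have hv : 0 ≤ volume.real (tsupport f) := measureReal_nonneg
    refine (key (ε / (volume.real (tsupport f) + 1)) (by positivity)).trans ?_
    gcongr
    rw [div_mul_eq_mul_div, div_le_iff₀ (by positivity)]
    nlinarith
  rw [← ofReal_integral_norm_eq_lintegral_enorm hfi]
  exact ENNReal.ofReal_le_ofReal hA

/-- **Strauss' inequality** for smooth fields: the symmetrised gradient controls the critical
Lebesgue norm. -/
theorem exists_lintegral_rpow_le_of_hasSymDerivBound (b₀ : OrthonormalBasis ι ℝ V) {p : ℝ}
    (hp : Real.HolderConjugate (Fintype.card ι) p) :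
    ∃ C : ℝ≥0, ∀ (w : V → V) (A : ℝ), ContDiff ℝ ∞ w → HasCompactSupport w →
      HasSymDerivBound w A → ∫⁻ x, ‖w x‖ₑ ^ p ≤ C * ENNReal.ofReal A ^ p := by
  obtain ⟨S, C, hC⟩ := exists_norm_rpow_le_sum_prod_inner b₀ hp
  refine ⟨C * (S.card * (Fintype.card ι : ℝ≥0) ^ p), fun w A hw hwc hA => ?_⟩
  have hbasis : ∀ b : OrthonormalBasis ι ℝ V,
      ∫⁻ x, ∏ i, ‖inner ℝ (b i) (w x)‖ₑ ^ ((1 : ℝ) / (Fintype.card ι - 1 : ℝ)) ≤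
        (Fintype.card ι * ENNReal.ofReal A) ^ p := by
    intro b
    refine (lintegral_prod_inner_le (hw.of_le (by simp)) hwc b hp).trans ?_
    refine ENNReal.rpow_le_rpow ?_ hp.symm.nonneg
    have hg : ∀ i, ContDiff ℝ ∞ (fun y => inner ℝ (b i) (w y)) := fun i =>
      contDiff_const.inner ℝ hw
    rw [lintegral_finsetSum' _ fun i _ =>
      ((((hg i).continuous_fderiv (by simp)).clm_apply
        continuous_const).measurable.enorm).aemeasurable]
    refine (Finset.sum_le_sum fun i _ => lintegral_fderiv_le_of_forall_integral_le (hg i)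
      (hwc.comp_left (g := fun z => inner ℝ (b i) z) (inner_zero_right _)) (b i)
      (hA (b i) (b.orthonormal.1 i))).trans ?_
    simp
  calc ∫⁻ x, ‖w x‖ₑ ^ p
      ≤ ∫⁻ x, C * ∑ b ∈ S,
        ∏ i, ‖inner ℝ (b i) (w x)‖ₑ ^ ((1 : ℝ) / (Fintype.card ι - 1 : ℝ)) :=
        lintegral_mono fun x => hC (w x)
    _ = C * ∑ b ∈ S, ∫⁻ x,
        ∏ i, ‖inner ℝ (b i) (w x)‖ₑ ^ ((1 : ℝ) / (Fintype.card ι - 1 : ℝ)) := by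
        have hm : ∀ b : OrthonormalBasis ι ℝ V, Measurable fun x =>
            ∏ i, ‖inner ℝ (b i) (w x)‖ₑ ^ ((1 : ℝ) / (Fintype.card ι - 1 : ℝ)) := fun b =>
          Finset.measurable_fun_prod _ fun i _ =>
            (continuous_const.inner hw.continuous).measurable.enorm.pow_const _
        rw [lintegral_const_mul _ (Finset.measurable_fun_sum _ fun b _ => hm b),
          lintegral_finsetSum _ fun b _ => hm b]
    _ ≤ C * ∑ b ∈ S, (Fintype.card ι * ENNReal.ofReal A) ^ p := by
        gcongr with b _
        exact hbasis b
    _ = _ := by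
        rw [Finset.sum_const, nsmul_eq_mul, ENNReal.mul_rpow_of_nonneg _ _ hp.symm.nonneg]
        push_cast
        rw [ENNReal.coe_rpow_of_nonneg _ hp.symm.nonneg]
        push_cast
        ring

end Strauss

/-! ### Strauss' inequality without smoothness. -/

section Mollification

open ContinuousLinearMap
open scoped Convolution

variable {ι V : Type*} [Fintype ι] [NormedAddCommGroup V] [InnerProductSpace ℝ V]
  [FiniteDimensional ℝ V] [MeasurableSpace V] [BorelSpace V]

/-- The convolution averages translates of `w` with total weight 1, and the bound is translation
invariant because the class of test functions is. -/
theorem HasSymDerivBound.convolution {w : V → V} {A : ℝ} (hw : Integrable w)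
    (hA : HasSymDerivBound w A) (φ : ContDiffBump (0 : V)) :
    HasSymDerivBound (φ.normed volume ⋆[lsmul ℝ ℝ, volume] w) A := by
  intro e he ψ hψ hψc hψ1
  set ρ : V → ℝ := φ.normed volume with hρ
  have hρc : Continuous ρ := φ.continuous_normed
  have hρi : Integrable ρ := φ.integrable_normed
  set g : V → ℝ := fun x => inner ℝ e (w x) with hg
  have hgi : Integrable g := hw.const_inner e
  set d : V → ℝ := fun x => fderiv ℝ ψ x e with hd
  have hdc : Continuous d := (hψ.continuous_fderiv (by simp)).clm_apply continuous_const
  have hds : HasCompactSupport d := hψc.fderiv_apply ℝ e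
  obtain ⟨B, hB⟩ := hdc.bounded_above_of_compact_support hds
  have hconv : ∀ x, inner ℝ e ((ρ ⋆[lsmul ℝ ℝ, volume] w) x) = ∫ t, ρ t * g (x - t) := by
    intro x
    have hex : ConvolutionExistsAt ρ w x (lsmul ℝ ℝ) volume :=
      φ.hasCompactSupport_normed.convolutionExists_left _ hρc hw.locallyIntegrable x
    rw [convolution_def, ← integral_inner hex.integrable]
    simp [inner_smul_right, hg]
  have hprod : Integrable (fun q : V × V => ρ q.2 * g (q.1 - q.2) * d q.1)
      (volume.prod volume) := by
    refine (hρi.convolution_integrand (ContinuousLinearMap.mul ℝ ℝ) hgi).mul_bdd (c := B) ?_ ?_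
    · exact (hdc.comp continuous_fst).aestronglyMeasurable
    · exact ae_of_all _ fun q => hB q.1
  have hinner : ∀ t, |∫ x, g (x - t) * d x| ≤ A := by
    intro t
    have h1 : ∫ x, g (x - t) * d x = ∫ x, g x * d (x + t) := by
      rw [← integral_add_right_eq_self (fun x => g (x - t) * d x) t]
      simp
    rw [h1]
    have h2 := hA e he (fun x => ψ (x + t)) (hψ.comp (by fun_prop))
      (hψc.comp_homeomorph (Homeomorph.addRight t)) (fun x => hψ1 _)
    simpa only [fderiv_comp_add_right] using h2
  calc |∫ x, inner ℝ e ((ρ ⋆[lsmul ℝ ℝ, volume] w) x) * d x|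
      = |∫ x, ∫ t, ρ t * g (x - t) * d x| := by
        simp only [hconv, integral_mul_const]
    _ = |∫ t, ρ t * ∫ x, g (x - t) * d x| := by
        rw [integral_integral_swap hprod]
        simp only [mul_assoc, integral_const_mul]
    _ ≤ ∫ t, ρ t * A := by
        rw [← Real.norm_eq_abs]
        refine norm_integral_le_of_norm_le (hρi.mul_const A) (ae_of_all _ fun t => ?_)
        rw [norm_mul, Real.norm_of_nonneg (φ.nonneg_normed t)]
        exact mul_le_mul_of_nonneg_left (hinner t) (φ.nonneg_normed t)
    _ = A := by rw [integral_mul_const, φ.integral_normed, one_mul]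

/-- **Strauss' inequality** for integrable fields of bounded deformation with compact support. -/
theorem exists_lintegral_rpow_le_of_integrable_of_hasSymDerivBound (b₀ : OrthonormalBasis ι ℝ V)
    {p : ℝ} (hp : Real.HolderConjugate (Fintype.card ι) p) :
    ∃ C : ℝ≥0, ∀ (w : V → V) (A : ℝ), Integrable w → HasCompactSupport w →
      HasSymDerivBound w A → ∫⁻ x, ‖w x‖ₑ ^ p ≤ C * ENNReal.ofReal A ^ p := by
  obtain ⟨C, hC⟩ := exists_lintegral_rpow_le_of_hasSymDerivBound b₀ hp
  refine ⟨C, fun w A hw hwc hA => ?_⟩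
  -- The fixed ratio 2 between the radii is what a.e. convergence of the mollifications requires;
  -- the norm bound then passes to the limit by Fatou.
  set φ : ℕ → ContDiffBump (0 : V) := fun k =>
    { rIn := 1 / ((k : ℝ) + 1)
      rOut := 2 * (1 / ((k : ℝ) + 1))
      rIn_pos := by positivity
      rIn_lt_rOut := by
        have : 0 < 1 / ((k : ℝ) + 1) := by positivity
        linarith } with hφ
  set W : ℕ → V → V := fun k => (φ k).normed volume ⋆[lsmul ℝ ℝ, volume] w with hW
  have hWs : ∀ k, ContDiff ℝ ∞ (W k) := fun k =>
    (φ k).hasCompactSupport_normed.contDiff_convolution_left _ (φ k).contDiff_normed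
      hw.locallyIntegrable
  have hWc : ∀ k, HasCompactSupport (W k) := fun k =>
    (φ k).hasCompactSupport_normed.convolution _ hwc
  have hlim : ∀ᵐ x, Tendsto (fun k => W k x) atTop (𝓝 (w x)) := by
    refine ContDiffBump.ae_convolution_tendsto_right_of_locallyIntegrable (K := 2) ?_ ?_
      hw.locallyIntegrable
    · simpa [hφ] using (tendsto_one_div_add_atTop_nhds_zero_nat (𝕜 := ℝ)).const_mul 2
    · exact Eventually.of_forall fun k => le_rfl
  calc ∫⁻ x, ‖w x‖ₑ ^ p
      = ∫⁻ x, liminf (fun k => ‖W k x‖ₑ ^ p) atTop := by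
        refine lintegral_congr_ae (hlim.mono fun x hx => ?_)
        exact (((ENNReal.continuous_rpow_const.comp continuous_enorm).tendsto _).comp
          hx).liminf_eq.symm
    _ ≤ liminf (fun k => ∫⁻ x, ‖W k x‖ₑ ^ p) atTop :=
        lintegral_liminf_le fun k => (hWs k).continuous.measurable.enorm.pow_const p
    _ ≤ C * ENNReal.ofReal A ^ p :=
        liminf_le_of_frequently_le' (Frequently.of_forall fun k =>
          hC _ A (hWs k) (hWc k) (hA.convolution hw (φ k)))

end Mollification

/-! ### Measures carried by their atoms. -/

section Atomic

variable {X : Type*} [MeasurableSpace X]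

theorem MeasureTheory.Measure.countable_setOf_measure_singleton_ne_zero
    [MeasurableSingletonClass X] (ν : Measure X) [SFinite ν] : {x | ν {x} ≠ 0}.Countable := by
  have := Measure.countable_meas_pos_of_disjoint_iUnion (μ := ν) (As := fun x : X => {x})
    (fun x => measurableSet_singleton x) (fun x y h => by simpa using h)
  simpa [pos_iff_ne_zero] using this

theorem MeasureTheory.Measure.eq_sum_dirac_of_measure_compl_eq_zero [MeasurableSingletonClass X]
    (ν : Measure X) [IsFiniteMeasure ν] {D : Set X} (hD : D.Countable) (h : ν Dᶜ = 0) :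
    ν = Measure.sum fun x : D => ENNReal.ofReal (ν.real {(x : X)}) • Measure.dirac (x : X) := by
  have hres : ν.restrict D = ν := Measure.restrict_eq_self_of_ae_mem (by
    simpa [mem_ae_iff] using h)
  ext s hs
  rw [Measure.sum_apply _ hs]
  nth_rw 1 [← hres]
  rw [← lintegral_indicator_one hs, lintegral_countable _ hD]
  refine tsum_congr fun x => ?_
  rw [Measure.smul_apply, Measure.dirac_apply' _ hs, smul_eq_mul, mul_comm,
    ofReal_measureReal]

variable [TopologicalSpace X]

/-- Inner regularity: exhaust each `A i` by compact subsets, which remain disjoint, and pass to the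
limit in the finite sum. -/
theorem sum_rpow_measure_le_of_forall_isCompact [BorelSpace X] (ν : Measure X)
    [IsFiniteMeasure ν] [ν.InnerRegularCompactLTTop] {θ : ℝ} {M : ℝ≥0∞}
    (h : ∀ (s : Finset ℕ) (K : ℕ → Set X), (∀ i, IsCompact (K i)) →
      Pairwise (Function.onFun Disjoint K) → ∑ i ∈ s, ν (K i) ^ θ ≤ M)
    (s : Finset ℕ) {A : ℕ → Set X} (hA : ∀ i, MeasurableSet (A i))
    (hd : Pairwise (Function.onFun Disjoint A)) : ∑ i ∈ s, ν (A i) ^ θ ≤ M := by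
  have hε : ∀ m : ℕ, ((m : ℝ≥0∞) + 1)⁻¹ ≠ 0 := fun m => by
    simp
  choose K hKA hKc hK using fun (m i : ℕ) =>
    (hA i).exists_isCompact_lt_add (measure_ne_top ν (A i)) (hε m)
  have hlim : ∀ i, Tendsto (fun m => ν (K m i)) atTop (𝓝 (ν (A i))) := by
    intro i
    have h0 : Tendsto (fun m : ℕ => ν (A i) - ((m : ℝ≥0∞) + 1)⁻¹) atTop (𝓝 (ν (A i))) := by
      have h1 : Tendsto (fun m : ℕ => ((m : ℝ≥0∞) + 1)⁻¹) atTop (𝓝 0) := by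
        have := ENNReal.tendsto_inv_nat_nhds_zero.comp (tendsto_add_atTop_nat 1)
        simpa [Function.comp_def] using this
      have := ENNReal.Tendsto.sub (tendsto_const_nhds (x := ν (A i))) h1
        (Or.inl (measure_ne_top ν (A i)))
      simpa using this
    exact tendsto_of_tendsto_of_tendsto_of_le_of_le h0 tendsto_const_nhds
      (fun m => tsub_le_iff_right.2 (hK m i).le) (fun m => measure_mono (hKA m i))
  have hsum : Tendsto (fun m => ∑ i ∈ s, ν (K m i) ^ θ) atTop (𝓝 (∑ i ∈ s, ν (A i) ^ θ)) :=
    tendsto_finsetSum s fun i _ => (ENNReal.continuous_rpow_const.tendsto _).comp (hlim i)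
  exact le_of_tendsto' hsum fun m => h s (K m) (hKc m)
    fun i j hij => (hd hij).mono (hKA m i) (hKA m j)

/-- A finite measure `ν` for which `∑ ν(Kᵢ) ^ θ` is bounded over all disjoint families of compact
sets, with some exponent `θ < 1`, is carried by its atoms. -/
theorem measure_setOf_singleton_eq_zero_of_sum_rpow_le [BorelSpace X] [T1Space X]
    [SecondCountableTopology X] (ν : Measure X) [IsFiniteMeasure ν]
    [ν.InnerRegularCompactLTTop] [ν.OuterRegular] {θ : ℝ} (hθ0 : 0 < θ) (hθ : θ < 1) {M : ℝ≥0∞}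
    (hM : M ≠ ⊤)
    (h : ∀ (s : Finset ℕ) (K : ℕ → Set X), (∀ i, IsCompact (K i)) →
      Pairwise (Function.onFun Disjoint K) → ∑ i ∈ s, ν (K i) ^ θ ≤ M) :
    ν {x | ν {x} = 0} = 0 := by
  set N : Set X := {x | ν {x} = 0} with hN
  have hNm : MeasurableSet N := by
    have h : N = {x | ν {x} ≠ 0}ᶜ := by ext x; simp [hN]
    rw [h]
    exact ν.countable_setOf_measure_singleton_ne_zero.measurableSet.compl
  have key : ∀ ε : ℝ≥0∞, 0 < ε → ε ≠ ⊤ → ν N ≤ ε ^ (1 - θ) * M := by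
    intro ε hε hεt
    have hex : ∀ x : X, ∃ U : Set X, x ∈ N → U ∈ 𝓝[N] x ∧ IsOpen U ∧ ν U < ε := by
      intro x
      by_cases hx : x ∈ N
      · obtain ⟨U, hxU, hU, hνU⟩ := Set.exists_isOpen_lt_of_lt {x} ε
          (by rw [show ν {x} = 0 from hx]; exact hε)
        exact ⟨U, fun _ => ⟨mem_nhdsWithin_of_mem_nhds (hU.mem_nhds (hxU rfl)), hU, hνU⟩⟩
      · exact ⟨∅, fun h => absurd h hx⟩
    choose U hU using hex
    obtain ⟨t, htN, htc, hcov⟩ := countable_cover_nhdsWithin (f := U) (s := N)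
      fun x hx => (hU x hx).1
    rcases t.eq_empty_or_nonempty with rfl | hne
    · have : N = ∅ := by simpa using hcov
      simp [this]
    obtain ⟨g, rfl⟩ := htc.exists_eq_range hne
    have hg : ∀ k, g k ∈ N := fun k => htN ⟨k, rfl⟩
    -- A countable subcover of `N` by open sets of measure below `ε`, made disjoint.
    set A : ℕ → Set X := fun k => disjointed (fun k => U (g k)) k ∩ N with hAdef
    have hAm : ∀ k, MeasurableSet (A k) := fun k =>
      (MeasurableSet.disjointed (fun k => (hU _ (hg k)).2.1.measurableSet) k).inter hNm
    have hAd : Pairwise (Function.onFun Disjoint A) := fun i j hij =>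
      (disjoint_disjointed (fun k => U (g k)) hij).mono Set.inter_subset_left Set.inter_subset_left
    have hAε : ∀ k, ν (A k) ≤ ε := fun k =>
      (measure_mono (Set.inter_subset_left.trans (disjointed_subset _ k))).trans
        (hU _ (hg k)).2.2.le
    have hNA : N ⊆ ⋃ k, A k := by
      rw [hAdef, ← Set.iUnion_inter, iUnion_disjointed]
      exact Set.subset_inter (by simpa using hcov) subset_rfl
    -- Here `θ < 1` enters: the spare factor `ν (A k) ^ (1 - θ)` is small.
    have hpt : ∀ k, ν (A k) ≤ ε ^ (1 - θ) * ν (A k) ^ θ := by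
      intro k
      calc ν (A k) = ν (A k) ^ (1 - θ) * ν (A k) ^ θ := by
            rw [← ENNReal.rpow_add_of_nonneg _ _ (by linarith) hθ0.le]; simp
        _ ≤ _ := by
            refine mul_le_mul_left ?_ _
            exact ENNReal.rpow_le_rpow (hAε k) (by linarith)
    calc ν N ≤ ν (⋃ k, A k) := measure_mono hNA
      _ ≤ ∑' k, ν (A k) := measure_iUnion_le _
      _ ≤ ∑' k, ε ^ (1 - θ) * ν (A k) ^ θ := ENNReal.tsum_le_tsum hpt
      _ = ε ^ (1 - θ) * ∑' k, ν (A k) ^ θ := ENNReal.tsum_mul_left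
      _ ≤ ε ^ (1 - θ) * M := by
          gcongr
          rw [ENNReal.tsum_eq_iSup_sum]
          exact iSup_le fun s => sum_rpow_measure_le_of_forall_isCompact ν h s hAm hAd
  have hlim : Tendsto (fun ε : ℝ≥0∞ => ε ^ (1 - θ) * M) (𝓝[>] 0) (𝓝 (0 * M)) := by
    refine ENNReal.Tendsto.mul_const ?_ (Or.inr hM)
    have := (ENNReal.continuous_rpow_const (y := 1 - θ)).tendsto 0
    rw [ENNReal.zero_rpow_of_pos (by linarith)] at this
    exact this.mono_left nhdsWithin_le_nhds
  rw [zero_mul] at hlim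
  refine le_antisymm (ge_of_tendsto hlim ?_) zero_le
  have h1 : ∀ᶠ ε : ℝ≥0∞ in 𝓝[>] 0, ε < 1 := nhdsWithin_le_nhds (Iio_mem_nhds one_pos)
  filter_upwards [self_mem_nhdsWithin, h1] with ε h0 h1
  exact key ε h0 (h1.trans ENNReal.one_lt_top).ne

end Atomic

/-! ### Localising functionals on `C₀`. -/

section Functional

open scoped BoundedContinuousFunction

variable {X : Type*} [TopologicalSpace X]

/-- Multiplication by `φ ∈ C₀(X)`, as an operator from bounded continuous functions to `C₀(X)`. -/
noncomputable def ZeroAtInftyContinuousMap.mulLeftCLM (φ : C₀(X, ℝ)) : (X →ᵇ ℝ) →L[ℝ] C₀(X, ℝ) :=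
  LinearMap.mkContinuous
    { toFun := fun ψ =>
        { toFun := fun x => φ x * ψ x
          continuous_toFun := by fun_prop
          zero_at_infty' := by
            refine squeeze_zero_norm (a := fun x => ‖φ x‖ * ‖ψ‖) (fun x => ?_) ?_
            · rw [norm_mul]
              exact mul_le_mul_of_nonneg_left (ψ.norm_coe_le_norm x) (norm_nonneg _)
            · simpa using (zero_at_infty φ).norm.mul_const ‖ψ‖ }
      map_add' := fun ψ ψ' => by ext x; exact mul_add _ _ _
      map_smul' := fun c ψ => by ext x; exact mul_left_comm _ _ _ } ‖φ‖ fun ψ => by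
    rw [← ZeroAtInftyContinuousMap.norm_toBCF_eq_norm]
    refine (BoundedContinuousFunction.norm_le (by positivity)).2 fun x => ?_
    change ‖φ x * ψ x‖ ≤ _
    rw [norm_mul]
    gcongr
    · exact φ.toBCF.norm_coe_le_norm x
    · exact ψ.norm_coe_le_norm x

@[simp]
theorem ZeroAtInftyContinuousMap.mulLeftCLM_apply (φ : C₀(X, ℝ)) (ψ : X →ᵇ ℝ) (x : X) :
    φ.mulLeftCLM ψ x = φ x * ψ x := rfl

/-- Localising a functional on `C₀(X)` to disjointly supported cutoffs is superadditive for
the norms. -/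
theorem sum_norm_comp_mulLeftCLM_le {ι : Type*} (T : C₀(X, ℝ) →L[ℝ] ℝ) (s : Finset ι)
    (φ : ι → C₀(X, ℝ)) (hφ : ∀ i ∈ s, ∀ x, |φ i x| ≤ 1)
    (hd : ∀ i ∈ s, ∀ j ∈ s, i ≠ j → ∀ x, φ i x = 0 ∨ φ j x = 0) :
    ∑ i ∈ s, ‖T ∘L (φ i).mulLeftCLM‖ ≤ ‖T‖ := by
  have key : ∀ r : ι → ℝ, (∀ i, r i < ‖T ∘L (φ i).mulLeftCLM‖) → ∑ i ∈ s, r i ≤ ‖T‖ := by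
    intro r hr
    have hex : ∀ i, ∃ ψ : X →ᵇ ℝ, ‖ψ‖ ≤ 1 ∧ r i ≤ T ((φ i).mulLeftCLM ψ) := by
      intro i
      obtain ⟨ψ, h1, h2⟩ := ContinuousLinearMap.exists_lt_apply_of_lt_opNorm _ (hr i)
      rw [Real.norm_eq_abs, lt_abs] at h2
      rcases h2 with h2 | h2
      · exact ⟨ψ, h1.le, h2.le⟩
      · exact ⟨-ψ, by simpa using h1.le, by simpa using h2.le⟩
    choose ψ hψ1 hψ2 using hex
    -- At each point at most one summand is nonzero, so the near-optimal `ψ i` glue to a single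
    -- competitor for `‖T‖`.
    have hnorm : ‖∑ i ∈ s, (φ i).mulLeftCLM (ψ i)‖ ≤ 1 := by
      rw [← ZeroAtInftyContinuousMap.norm_toBCF_eq_norm]
      refine (BoundedContinuousFunction.norm_le zero_le_one).2 fun x => ?_
      have hx : (∑ i ∈ s, (φ i).mulLeftCLM (ψ i)).toBCF x = ∑ i ∈ s, φ i x * ψ i x := by
        change (∑ i ∈ s, (φ i).mulLeftCLM (ψ i)) x = _
        clear hφ hd
        induction s using Finset.cons_induction with
        | empty => simp
        | cons a s ha ih =>
          rw [Finset.sum_cons, Finset.sum_cons, ZeroAtInftyContinuousMap.add_apply, ih]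
          rfl
      rw [hx]
      have hle : ∀ i ∈ s, |φ i x * ψ i x| ≤ 1 := fun i hi => by
        rw [abs_mul]
        exact mul_le_one₀ (hφ i hi x) (abs_nonneg _)
          (((ψ i).norm_coe_le_norm x).trans (hψ1 i))
      by_cases hall : ∀ i ∈ s, φ i x = 0
      · rw [Finset.sum_eq_zero fun i hi => by rw [hall i hi, zero_mul]]
        simp
      · push Not at hall
        obtain ⟨i, hi, hix⟩ := hall
        rw [Finset.sum_eq_single_of_mem i hi fun j hj hij => by
          rw [(hd i hi j hj hij.symm x).resolve_left hix, zero_mul]]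
        exact hle i hi
    calc ∑ i ∈ s, r i ≤ ∑ i ∈ s, T ((φ i).mulLeftCLM (ψ i)) := Finset.sum_le_sum fun i _ => hψ2 i
      _ = T (∑ i ∈ s, (φ i).mulLeftCLM (ψ i)) := (map_sum T _ _).symm
      _ ≤ ‖T‖ * ‖∑ i ∈ s, (φ i).mulLeftCLM (ψ i)‖ := (le_abs_self _).trans (T.le_opNorm _)
      _ ≤ ‖T‖ := mul_le_of_le_one_right T.opNorm_nonneg hnorm
  refine le_of_forall_pos_le_add fun ε hε => ?_
  have h := key (fun i => ‖T ∘L (φ i).mulLeftCLM‖ - ε / (s.card + 1)) fun i => by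
    have : 0 < ε / ((s.card : ℝ) + 1) := by positivity
    linarith
  rw [Finset.sum_sub_distrib, Finset.sum_const, nsmul_eq_mul] at h
  have h2 : (s.card : ℝ) * (ε / (s.card + 1)) ≤ ε := by
    rw [mul_div_assoc', div_le_iff₀ (by positivity)]
    nlinarith
  linarith

variable [MeasurableSpace X] [BorelSpace X]

/-- Integration against a finite signed measure, as a functional on `C₀(X)`. -/
noncomputable def MeasureTheory.SignedMeasure.toZeroAtInftyDual (σ : SignedMeasure X) :
    C₀(X, ℝ) →L[ℝ] ℝ :=
  haveI : IsFiniteMeasure σ.variation := by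
    rw [← SignedMeasure.totalVariation_eq_variation]; infer_instance
  have hi (f : C₀(X, ℝ)) : VectorMeasure.Integrable σ f :=
    BoundedContinuousFunction.integrable σ.variation f.toBCF
  LinearMap.mkContinuous
    { toFun := fun f => ∫ᵛ x, f x ∂<•σ
      map_add' := fun f g => VectorMeasure.integral_add (hi f) (hi g)
      map_smul' := fun c f => VectorMeasure.integral_smul f _ _ c }
    (‖(ContinuousLinearMap.lsmul ℝ ℝ : ℝ →L[ℝ] ℝ →L[ℝ] ℝ).flip‖ * σ.variation.real Set.univ)
    fun f => by
      refine (VectorMeasure.norm_integral_le_of_norm_le_const (C := ‖f‖)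
        (ae_of_all _ fun x => f.toBCF.norm_coe_le_norm x)).trans (le_of_eq ?_)
      ring

@[simp]
theorem MeasureTheory.SignedMeasure.toZeroAtInftyDual_apply (σ : SignedMeasure X) (f : C₀(X, ℝ)) :
    σ.toZeroAtInftyDual f = ∫ᵛ x, f x ∂<•σ := rfl

end Functional

/-! ### Smooth cutoffs for disjoint compact sets. -/

section Cutoff

variable {V : Type*} [NormedAddCommGroup V] [NormedSpace ℝ V] {Ω : Opens V}

theorem TestFunction.tendsto_zero_cocompact (φ : 𝓓(Ω, ℝ)) :
    Tendsto (fun x : Ω => φ x) (cocompact Ω) (𝓝 0) := by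
  refine tendsto_const_nhds.congr' ?_
  have hK : IsCompact ((Subtype.val : Ω → V) ⁻¹' tsupport φ) :=
    (IsInducing.subtypeVal.isCompact_preimage_iff (by
      rw [Subtype.range_coe]; exact φ.tsupport_subset)).2 φ.hasCompactSupport
  filter_upwards [hK.compl_mem_cocompact] with x hx
  exact (image_eq_zero_of_notMem_tsupport hx).symm

/-- The restriction of a test function on `Ω` to an element of `C₀(Ω)`. -/
noncomputable def TestFunction.toZeroAtInfty (φ : 𝓓(Ω, ℝ)) : C₀(Ω, ℝ) where
  toFun x := φ x
  continuous_toFun := φ.continuous.comp continuous_subtype_val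
  zero_at_infty' := φ.tendsto_zero_cocompact

@[simp]
theorem TestFunction.toZeroAtInfty_apply (φ : 𝓓(Ω, ℝ)) (x : Ω) : φ.toZeroAtInfty x = φ x := rfl

theorem TestFunction.exists_abs_fderiv_le (φ : 𝓓(Ω, ℝ)) :
    ∃ L : ℝ, 0 ≤ L ∧ ∀ x e, ‖e‖ = 1 → |fderiv ℝ φ x e| ≤ L := by
  obtain ⟨L, hL⟩ := (φ.contDiff.continuous_fderiv (by simp)).bounded_above_of_compact_support
    (φ.hasCompactSupport.fderiv ℝ)
  refine ⟨L, (norm_nonneg _).trans (hL 0), fun x e he => ?_⟩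
  refine ((fderiv ℝ φ x).le_opNorm e).trans ?_
  rw [he, mul_one]
  exact hL x

open scoped Manifold in
theorem TestFunction.exists_eq_one_of_isCompact [FiniteDimensional ℝ V] {K U : Set V}
    (hK : IsCompact K) (hU : IsOpen U) (hKU : K ⊆ U) (hUΩ : U ⊆ Ω) :
    ∃ φ : 𝓓(Ω, ℝ), (∀ x ∈ K, φ x = 1) ∧ (∀ x, 0 ≤ φ x ∧ φ x ≤ 1) ∧ ∀ x ∉ U, φ x = 0 := by
  have : ProperSpace V := FiniteDimensional.proper ℝ V
  obtain ⟨L, hL, hKL, hLU⟩ := exists_compact_between hK hU hKU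
  obtain ⟨f, hf, hf01, hf0, hf1⟩ := exists_contMDiff_zero_iff_one_iff_of_isClosed 𝓘(ℝ, V)
    (n := ⊤) (isOpen_interior (s := L)).isClosed_compl hK.isClosed
    (Set.disjoint_left.2 fun x hx hxK => hx (hKL hxK))
  have hsupp : tsupport f ⊆ L := closure_minimal (fun x hx => by
    by_contra hxL
    exact hx ((hf0 x).1 fun h => hxL (interior_subset h))) hL.isClosed
  refine ⟨⟨f, hf.contDiff, hL.of_isClosed_subset (isClosed_tsupport f) hsupp,
    (hsupp.trans hLU).trans hUΩ⟩, fun x hx => (hf1 x).1 hx, fun x => hf01 ⟨x, rfl⟩, fun x hx =>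
    (hf0 x).1 fun h => hx (hLU (interior_subset h))⟩

/-- Voronoi cells: take the points strictly closer to `K i` than to every other `K j`. The extended
distance also covers empty `K j`. -/
theorem exists_isOpen_disjoint_of_isCompact_disjoint {X ι : Type*} [EMetricSpace X] (s : Finset ι)
    {K : ι → Set X} (hK : ∀ i, IsCompact (K i)) (hd : Pairwise (Function.onFun Disjoint K)) :
    ∃ U : ι → Set X, (∀ i, IsOpen (U i)) ∧ (∀ i, K i ⊆ U i) ∧
      ∀ i ∈ s, ∀ j ∈ s, i ≠ j → Disjoint (U i) (U j) := by
  classical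
  refine ⟨fun i => ⋂ j ∈ s.erase i, {x | Metric.infEDist x (K i) < Metric.infEDist x (K j)},
    fun i => ?_, fun i x hx => ?_, fun i hi j hj hij => ?_⟩
  · exact isOpen_biInter_finset fun j _ =>
      isOpen_lt Metric.continuous_infEDist Metric.continuous_infEDist
  · refine Set.mem_iInter₂.2 fun j hj => ?_
    have hxj : x ∉ K j := Set.disjoint_left.1 (hd (Finset.ne_of_mem_erase hj).symm) hx
    rw [Set.mem_ofPred_eq, Metric.infEDist_zero_of_mem hx, pos_iff_ne_zero]
    exact fun h => hxj ((Metric.mem_iff_infEDist_zero_of_closed (hK j).isClosed).2 h)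
  · refine Set.disjoint_left.2 fun x hxi hxj => ?_
    have h1 := Set.mem_iInter₂.1 hxi j (Finset.mem_erase.2 ⟨hij.symm, hj⟩)
    have h2 := Set.mem_iInter₂.1 hxj i (Finset.mem_erase.2 ⟨hij, hi⟩)
    rw [Set.mem_ofPred_eq] at h1 h2
    exact lt_asymm h1 h2

theorem TestFunction.exists_disjoint_cutoffs [FiniteDimensional ℝ V] {ι : Type*} (s : Finset ι)
    {K : ι → Set Ω} (hK : ∀ i, IsCompact (K i)) (hd : Pairwise (Function.onFun Disjoint K)) :
    ∃ φ : ι → 𝓓(Ω, ℝ), (∀ i, ∀ x ∈ K i, φ i x = 1) ∧ (∀ i x, 0 ≤ φ i x ∧ φ i x ≤ 1) ∧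
      ∀ i ∈ s, ∀ j ∈ s, i ≠ j → ∀ x, φ i x = 0 ∨ φ j x = 0 := by
  obtain ⟨U, hUo, hKU, hUd⟩ := exists_isOpen_disjoint_of_isCompact_disjoint s
    (K := fun i => Subtype.val '' K i) (fun i => (hK i).image continuous_subtype_val)
    (fun i j hij => (Set.disjoint_image_iff Subtype.val_injective).2 (hd hij))
  choose φ h1 h2 h3 using fun i => TestFunction.exists_eq_one_of_isCompact
    (Ω := Ω) ((hK i).image continuous_subtype_val) ((hUo i).inter Ω.isOpen)
    (Set.subset_inter (hKU i) (by rintro _ ⟨x, -, rfl⟩; exact x.2)) Set.inter_subset_right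
  refine ⟨φ, fun i x hx => h1 i x ⟨x, hx, rfl⟩, h2, fun i hi j hj hij x => ?_⟩
  by_cases hx : x ∈ U i
  · exact Or.inr (h3 j x fun h => Set.disjoint_left.1 (hUd i hi j hj hij) hx h.1)
  · exact Or.inl (h3 i x fun h => hx h.1)

end Cutoff

/-! ### Strauss' inequality for a field times a cutoff. -/

section BD

variable {n : ℕ} {Ω : Opens (EuclideanSpace ℝ (Fin n))}

/-- The mass of `E(φ u)`, bounded by localising `σ = Eu` and estimating `∇φ ⊙ u`. -/
noncomputable def cutoffMass (u : Ω →₁[lebesgueOn Ω] EuclideanSpace ℝ (Fin n))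
    (σ : Matrix (Fin n) (Fin n) (SignedMeasure Ω)) (φ : 𝓓(Ω, ℝ)) (L : ℝ) : ℝ :=
  (∑ i, ∑ j, ‖(σ i j).toZeroAtInftyDual ∘L φ.toZeroAtInfty.mulLeftCLM‖) + L * ‖u‖

/-- Since `e i * e j` is symmetric, averaging the coordinate expansion with its transpose produces
the symmetrised gradient. -/
theorem integral_inner_mul_fderiv_eq_neg_sum {u : Ω →₁[lebesgueOn Ω] EuclideanSpace ℝ (Fin n)}
    {σ : Matrix (Fin n) (Fin n) (SignedMeasure Ω)} (hσ : IsSymGradient u σ) (θ : 𝓓(Ω, ℝ))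
    (e : EuclideanSpace ℝ (Fin n)) :
    ∫ x : Ω, inner ℝ e (u x) * fderiv ℝ θ x e ∂(lebesgueOn Ω) =
      -∑ i, ∑ j, e i * e j * (σ i j).toZeroAtInftyDual θ.toZeroAtInfty := by
  have hu : Integrable u (lebesgueOn Ω) := L1.integrable_coeFn u
  have hcomp : ∀ i, Integrable (fun x => u x i) (lebesgueOn Ω) := fun i =>
    (EuclideanSpace.proj (𝕜 := ℝ) i : EuclideanSpace ℝ (Fin n) →L[ℝ] ℝ).integrable_comp hu
  have hd : ∀ v, Continuous fun x : Ω => fderiv ℝ θ x v := fun v =>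
    ((θ.contDiff.continuous_fderiv (by simp)).clm_apply continuous_const).comp
      continuous_subtype_val
  obtain ⟨L, hL⟩ := (θ.contDiff.continuous_fderiv (by simp)).bounded_above_of_compact_support
    (θ.hasCompactSupport.fderiv ℝ)
  have hint : ∀ i v, Integrable (fun x : Ω => u x i * fderiv ℝ θ x v) (lebesgueOn Ω) := by
    intro i v
    refine (hcomp i).mul_bdd (c := L * ‖v‖) (hd v).aestronglyMeasurable (ae_of_all _ fun x => ?_)
    exact ((fderiv ℝ θ x).le_opNorm v).trans
      (mul_le_mul_of_nonneg_right (hL x) (norm_nonneg v))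
  have hpt : ∀ x : Ω, inner ℝ e (u x) * fderiv ℝ θ x e =
      ∑ i, ∑ j, e i * e j * ((u x i * fderiv ℝ θ x (EuclideanSpace.single j 1)
        + u x j * fderiv ℝ θ x (EuclideanSpace.single i 1)) / 2) := by
    intro x
    have he : fderiv ℝ θ x e = ∑ j, e j * fderiv ℝ θ x (EuclideanSpace.single j 1) := by
      conv_lhs => rw [← (EuclideanSpace.basisFun (Fin n) ℝ).sum_repr e, map_sum]
      simp
    have hin : inner ℝ e (u x) = ∑ i, e i * u x i := by
      simp [PiLp.inner_apply, mul_comm]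
    have h1 : inner ℝ e (u x) * fderiv ℝ θ x e =
        ∑ i, ∑ j, e i * e j * (u x i * fderiv ℝ θ x (EuclideanSpace.single j 1)) := by
      rw [hin, he, Finset.sum_mul_sum]
      exact Finset.sum_congr rfl fun i _ => Finset.sum_congr rfl fun j _ => by ring
    have h2 : inner ℝ e (u x) * fderiv ℝ θ x e =
        ∑ i, ∑ j, e i * e j * (u x j * fderiv ℝ θ x (EuclideanSpace.single i 1)) := by
      rw [h1, Finset.sum_comm]
      exact Finset.sum_congr rfl fun i _ => Finset.sum_congr rfl fun j _ => by ring
    calc inner ℝ e (u x) * fderiv ℝ θ x e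
        = (inner ℝ e (u x) * fderiv ℝ θ x e + inner ℝ e (u x) * fderiv ℝ θ x e) / 2 := by ring
      _ = _ := by
        nth_rw 1 [h1]
        rw [h2, ← Finset.sum_add_distrib, Finset.sum_div]
        refine Finset.sum_congr rfl fun i _ => ?_
        rw [← Finset.sum_add_distrib, Finset.sum_div]
        exact Finset.sum_congr rfl fun j _ => by ring
  have hint' : ∀ i j, Integrable (fun x : Ω => e i * e j *
      ((u x i * fderiv ℝ θ x (EuclideanSpace.single j 1)
        + u x j * fderiv ℝ θ x (EuclideanSpace.single i 1)) / 2)) (lebesgueOn Ω) := fun i j =>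
    (((hint i _).add (hint j _)).div_const 2).const_mul _
  simp_rw [hpt]
  rw [integral_finsetSum _ fun i _ => integrable_finsetSum _ fun j _ => hint' i j,
    ← Finset.sum_neg_distrib]
  refine Finset.sum_congr rfl fun i _ => ?_
  rw [integral_finsetSum _ fun j _ => hint' i j, ← Finset.sum_neg_distrib]
  refine Finset.sum_congr rfl fun j _ => ?_
  rw [integral_const_mul, SignedMeasure.toZeroAtInftyDual_apply]
  have := hσ i j θ
  simp only [TestFunction.toZeroAtInfty_apply]
  rw [this]
  ring

/-- Leibniz: `φ ∂ψ = ∂(φψ) - ψ ∂φ`. The first term pairs `ψ` with the localised `σ`; the second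
costs `L * ‖u‖`. Only `φψ` has to be a test function, so `ψ` needs no compact support. -/
theorem abs_integral_cutoff_inner_mul_fderiv_le
    {u : Ω →₁[lebesgueOn Ω] EuclideanSpace ℝ (Fin n)}
    {σ : Matrix (Fin n) (Fin n) (SignedMeasure Ω)} (hσ : IsSymGradient u σ) (φ : 𝓓(Ω, ℝ))
    {L : ℝ} (hL : ∀ x e, ‖e‖ = 1 → |fderiv ℝ φ x e| ≤ L) {e : EuclideanSpace ℝ (Fin n)}
    (he : ‖e‖ = 1) {ψ : EuclideanSpace ℝ (Fin n) → ℝ} (hψ : ContDiff ℝ ∞ ψ)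
    (hψ1 : ∀ x, |ψ x| ≤ 1) :
    |∫ x : Ω, φ x * inner ℝ e (u x) * fderiv ℝ ψ x e ∂(lebesgueOn Ω)| ≤ cutoffMass u σ φ L := by
  have hu : Integrable u (lebesgueOn Ω) := L1.integrable_coeFn u
  have hue : Integrable (fun x => inner ℝ e (u x)) (lebesgueOn Ω) := hu.const_inner e
  have hL0 : 0 ≤ L := (abs_nonneg _).trans (hL 0 e he)
  set θ : 𝓓(Ω, ℝ) := ⟨fun x => φ x * ψ x, φ.contDiff.mul hψ, φ.hasCompactSupport.mul_right,
    (closure_mono (Function.support_mul_subset_left _ _)).trans φ.tsupport_subset⟩ with hθ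
  have hθd : ∀ x, fderiv ℝ θ x e = φ x * fderiv ℝ ψ x e + ψ x * fderiv ℝ φ x e := by
    intro x
    have : fderiv ℝ θ x = φ x • fderiv ℝ ψ x + ψ x • fderiv ℝ φ x :=
      fderiv_fun_mul (φ.contDiff.differentiable (by simp) x) (hψ.differentiable (by simp) x)
    rw [this]
    simp
  obtain ⟨B, -, hB⟩ := θ.exists_abs_fderiv_le
  have hi1 : Integrable (fun x : Ω => inner ℝ e (u x) * fderiv ℝ θ x e) (lebesgueOn Ω) :=
    hue.mul_bdd (c := B) ((((θ.contDiff.continuous_fderiv (by simp)).clm_apply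
      continuous_const).comp continuous_subtype_val).aestronglyMeasurable)
      (ae_of_all _ fun x => hB x e he)
  have hle2 : ∀ x : Ω, ‖ψ x * fderiv ℝ φ x e‖ ≤ L := fun x => by
    rw [norm_mul]
    exact (mul_le_of_le_one_left (norm_nonneg _) (hψ1 x)).trans (hL x e he)
  have hi2 : Integrable (fun x : Ω => inner ℝ e (u x) * (ψ x * fderiv ℝ φ x e))
      (lebesgueOn Ω) :=
    hue.mul_bdd (c := L) (((hψ.continuous.mul ((φ.contDiff.continuous_fderiv
      (by simp)).clm_apply continuous_const)).comp continuous_subtype_val).aestronglyMeasurable)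
      (ae_of_all _ hle2)
  have hsplit : ∫ x : Ω, φ x * inner ℝ e (u x) * fderiv ℝ ψ x e ∂(lebesgueOn Ω) =
      (∫ x : Ω, inner ℝ e (u x) * fderiv ℝ θ x e ∂(lebesgueOn Ω)) -
      ∫ x : Ω, inner ℝ e (u x) * (ψ x * fderiv ℝ φ x e) ∂(lebesgueOn Ω) := by
    rw [← integral_sub hi1 hi2]
    refine integral_congr_ae (ae_of_all _ fun x => ?_)
    simp only [hθd]
    ring
  have hfirst : |∫ x : Ω, inner ℝ e (u x) * fderiv ℝ θ x e ∂(lebesgueOn Ω)| ≤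
      ∑ i, ∑ j, ‖(σ i j).toZeroAtInftyDual ∘L φ.toZeroAtInfty.mulLeftCLM‖ := by
    set ψb : BoundedContinuousFunction Ω ℝ := BoundedContinuousFunction.ofNormedAddCommGroup
      (fun x : Ω => ψ x) (hψ.continuous.comp continuous_subtype_val) 1 (fun x => hψ1 x) with hψb
    have hψbn : ‖ψb‖ ≤ 1 :=
      (BoundedContinuousFunction.norm_le zero_le_one).2 fun x => hψ1 x
    have hθ0 : θ.toZeroAtInfty = φ.toZeroAtInfty.mulLeftCLM ψb := rfl
    have hei : ∀ i, |e i| ≤ 1 := fun i => (PiLp.norm_apply_le e i).trans he.le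
    rw [integral_inner_mul_fderiv_eq_neg_sum hσ, abs_neg]
    refine (Finset.abs_sum_le_sum_abs _ _).trans (Finset.sum_le_sum fun i _ => ?_)
    refine (Finset.abs_sum_le_sum_abs _ _).trans (Finset.sum_le_sum fun j _ => ?_)
    rw [abs_mul, abs_mul]
    refine (mul_le_of_le_one_left (abs_nonneg _)
      (mul_le_one₀ (hei i) (abs_nonneg _) (hei j))).trans ?_
    rw [hθ0]
    exact (((σ i j).toZeroAtInftyDual ∘L φ.toZeroAtInfty.mulLeftCLM).le_opNorm ψb).trans
      (mul_le_of_le_one_right (ContinuousLinearMap.opNorm_nonneg _) hψbn)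
  have hsecond : |∫ x : Ω, inner ℝ e (u x) * (ψ x * fderiv ℝ φ x e) ∂(lebesgueOn Ω)| ≤
      L * ‖u‖ := by
    rw [L1.norm_eq_integral_norm, ← integral_const_mul, ← Real.norm_eq_abs]
    refine norm_integral_le_of_norm_le (hu.norm.const_mul L) (ae_of_all _ fun x => ?_)
    rw [norm_mul, mul_comm L]
    refine mul_le_mul ?_ (hle2 x) (norm_nonneg _) (norm_nonneg _)
    simpa [he] using norm_inner_le_norm (𝕜 := ℝ) e (u x)
  rw [hsplit, cutoffMass]
  exact (abs_sub _ _).trans (add_le_add hfirst hsecond)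

/-- Extended by zero, `φ u` is an integrable, compactly supported field on the whole space, so no
boundary regularity enters and `C` depends on `n` only. -/
theorem exists_rpow_integral_cutoff_le (hn : 2 ≤ n) :
    ∃ C : ℝ, 0 ≤ C ∧ ∀ (Ω : Opens (EuclideanSpace ℝ (Fin n)))
      (u : Ω →₁[lebesgueOn Ω] EuclideanSpace ℝ (Fin n))
      (σ : Matrix (Fin n) (Fin n) (SignedMeasure Ω)), IsSymGradient u σ →
      ∀ (φ : 𝓓(Ω, ℝ)), (∀ x, 0 ≤ φ x) → ∀ L : ℝ, (∀ x e, ‖e‖ = 1 → |fderiv ℝ φ x e| ≤ L) →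
      (∫ x : Ω, φ x ^ ((n : ℝ) / (n - 1)) * ‖u x‖ ^ ((n : ℝ) / (n - 1)) ∂(lebesgueOn Ω)) ^
        ((n : ℝ) / (n - 1))⁻¹ ≤ C * cutoffMass u σ φ L := by
  set p : ℝ := (n : ℝ) / (n - 1) with hp
  have hn1 : (1 : ℝ) < n := by exact_mod_cast hn
  have hconj : Real.HolderConjugate (Fintype.card (Fin n)) p := by
    rw [Fintype.card_fin, hp]
    exact Real.HolderConjugate.conjExponent hn1
  have hp0 : 0 < p := hconj.symm.pos
  obtain ⟨C, hC⟩ := exists_lintegral_rpow_le_of_integrable_of_hasSymDerivBound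
    (EuclideanSpace.basisFun (Fin n) ℝ) hconj
  refine ⟨(C : ℝ) ^ p⁻¹, by positivity, fun Ω u σ hσ φ hφ0 L hL => ?_⟩
  have hΩm : MeasurableSet (Ω : Set (EuclideanSpace ℝ (Fin n))) := Ω.isOpen.measurableSet
  have hu : Integrable u (lebesgueOn Ω) := L1.integrable_coeFn u
  set U : EuclideanSpace ℝ (Fin n) → EuclideanSpace ℝ (Fin n) :=
    Function.extend Subtype.val u 0 with hU
  have hUv : ∀ x : Ω, U x = u x := fun x => Subtype.val_injective.extend_apply _ _ x
  have hU0 : ∀ x ∉ (Ω : Set (EuclideanSpace ℝ (Fin n))), U x = 0 := fun x hx =>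
    Function.extend_apply' _ _ _ (by rintro ⟨y, rfl⟩; exact hx y.2)
  have hUi : Integrable U := by
    have hon : IntegrableOn U Ω := (integrableOn_iff_comap_subtypeVal hΩm).2 (by
      have : U ∘ (Subtype.val : Ω → _) = u := funext hUv
      rw [show (U ∘ fun x : (Ω : Set (EuclideanSpace ℝ (Fin n))) => (x : EuclideanSpace ℝ (Fin n)))
        = u from this]
      exact hu)
    exact hon.integrable_of_forall_notMem_eq_zero hU0
  set w : EuclideanSpace ℝ (Fin n) → EuclideanSpace ℝ (Fin n) := fun x => φ x • U x with hw
  obtain ⟨B, hB⟩ := φ.continuous.bounded_above_of_compact_support φ.hasCompactSupport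
  have hwi : Integrable w := hUi.bdd_smul B φ.continuous.aestronglyMeasurable
    (ae_of_all _ hB)
  have hwc : HasCompactSupport w := φ.hasCompactSupport.smul_right
  have hwA : HasSymDerivBound w (cutoffMass u σ φ L) := by
    intro e he ψ hψ _ hψ1
    have : ∫ x, inner ℝ e (w x) * fderiv ℝ ψ x e =
        ∫ x : Ω, φ x * inner ℝ e (u x) * fderiv ℝ ψ x e ∂(lebesgueOn Ω) := by
      rw [← setIntegral_eq_integral_of_forall_compl_eq_zero
        (s := (Ω : Set (EuclideanSpace ℝ (Fin n)))) fun x hx => by simp [hw, hU0 x hx],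
        ← integral_subtype_comap hΩm]
      refine integral_congr_ae (ae_of_all _ fun x => ?_)
      have := hUv x
      simp [hw, this, inner_smul_right]
    rw [this]
    exact abs_integral_cutoff_inner_mul_fderiv_le hσ φ hL he hψ hψ1
  -- Testing with `ψ = 0` at any unit vector gives the sign.
  have hA0 : 0 ≤ cutoffMass u σ φ L := by
    have hne : Nonempty (Fin n) := ⟨⟨0, by omega⟩⟩
    have h := hwA (EuclideanSpace.single (Classical.arbitrary _) 1) (by simp) 0 contDiff_const
      HasCompactSupport.zero (by simp)
    exact (abs_nonneg _).trans h
  have hbound := hC w _ hwi hwc hwA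
  have hle : ∫⁻ x : Ω, ENNReal.ofReal (φ x ^ p * ‖u x‖ ^ p) ∂(lebesgueOn Ω) ≤
      ENNReal.ofReal (C * cutoffMass u σ φ L ^ p) := by
    calc ∫⁻ x : Ω, ENNReal.ofReal (φ x ^ p * ‖u x‖ ^ p) ∂(lebesgueOn Ω)
        = ∫⁻ x : Ω, ‖w x‖ₑ ^ p ∂(lebesgueOn Ω) := by
          refine lintegral_congr fun x => ?_
          rw [← Real.mul_rpow (hφ0 x) (norm_nonneg _),
            ← ENNReal.ofReal_rpow_of_nonneg (mul_nonneg (hφ0 x) (norm_nonneg _)) hp0.le,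
            ← ofReal_norm (w x)]
          simp only [hw, hUv, norm_smul, Real.norm_of_nonneg (hφ0 x)]
      _ = ∫⁻ x in (Ω : Set (EuclideanSpace ℝ (Fin n))), ‖w x‖ₑ ^ p :=
          lintegral_subtype_comap hΩm fun x => ‖w x‖ₑ ^ p
      _ ≤ ∫⁻ x, ‖w x‖ₑ ^ p := setLIntegral_le_lintegral _ _
      _ ≤ _ := hbound
      _ = _ := by
          rw [ENNReal.ofReal_mul C.coe_nonneg, ENNReal.ofReal_coe_nnreal,
            ENNReal.ofReal_rpow_of_nonneg hA0 hp0.le]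
  have hreal : ∫ x : Ω, φ x ^ p * ‖u x‖ ^ p ∂(lebesgueOn Ω) ≤ C * cutoffMass u σ φ L ^ p := by
    rw [integral_eq_lintegral_of_nonneg_ae (ae_of_all _ fun x : Ω =>
      mul_nonneg (Real.rpow_nonneg (hφ0 x) _) (Real.rpow_nonneg (norm_nonneg _) _))]
    · exact ENNReal.toReal_le_of_le_ofReal
        (mul_nonneg C.coe_nonneg (Real.rpow_nonneg hA0 _)) hle
    · exact (((φ.continuous.comp continuous_subtype_val).rpow_const fun _ =>
        Or.inr hp0.le).aestronglyMeasurable).mul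
        (hu.aestronglyMeasurable.norm.aemeasurable.pow_const p).aestronglyMeasurable
  calc (∫ x : Ω, φ x ^ p * ‖u x‖ ^ p ∂(lebesgueOn Ω)) ^ p⁻¹
      ≤ (C * cutoffMass u σ φ L ^ p) ^ p⁻¹ :=
        Real.rpow_le_rpow (integral_nonneg fun x =>
          mul_nonneg (Real.rpow_nonneg (hφ0 x) _) (Real.rpow_nonneg (norm_nonneg _) _)) hreal
          (inv_nonneg.2 hp0.le)
    _ = (C : ℝ) ^ p⁻¹ * cutoffMass u σ φ L := by
        rw [Real.mul_rpow C.coe_nonneg (Real.rpow_nonneg hA0 _), Real.rpow_rpow_inv hA0 hp0.ne']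

end BD

/-! ### Passage to the limit and atomicity of `ν`. -/

section Concentration

variable {n : ℕ} {Ω : Opens (EuclideanSpace ℝ (Fin n))}

/-- Uniform boundedness principle: convergent sequences of pairings are bounded. -/
theorem BD.WeakStarTendsto.exists_norm_toZeroAtInftyDual_le {u : ℕ → BD Ω} {u' : BD Ω}
    (hu : BD.WeakStarTendsto u u') (i j : Fin n) :
    ∃ M : ℝ, ∀ k, ‖(BD.symGradient (u k) i j).toZeroAtInftyDual‖ ≤ M := by
  refine banach_steinhaus fun f => ?_
  obtain ⟨C, hC⟩ := (hu.2 i j f).norm.bddAbove_range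
  exact ⟨C, fun k => hC ⟨k, rfl⟩⟩

/-- The power `φ ^ p` of a nonnegative test function, as an element of `C₀(Ω)`. -/
noncomputable def TestFunction.rpowZeroAtInfty (φ : 𝓓(Ω, ℝ)) {p : ℝ} (hp : 0 < p) : C₀(Ω, ℝ) where
  toFun x := φ x ^ p
  continuous_toFun := (φ.continuous.comp continuous_subtype_val).rpow_const fun _ => Or.inr hp.le
  zero_at_infty' := by
    have h := φ.tendsto_zero_cocompact.rpow_const (p := p) (Or.inr hp.le)
    rwa [Real.zero_rpow hp.ne'] at h

theorem exists_sum_rpow_measure_le (hn : 2 ≤ n) {u : ℕ → BD Ω}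
    (hu : BD.WeakStarTendsto u ⟨0, BD.zero_mem Ω⟩) (ν : Measure Ω) [IsFiniteMeasure ν]
    (hν : ∀ f : C₀(Ω, ℝ),
      Tendsto (fun k => ∫ x : Ω, f x *
          ‖(u k : Ω →₁[lebesgueOn Ω] EuclideanSpace ℝ (Fin n)) x‖ ^ ((n : ℝ) / ((n : ℝ) - 1))
          ∂(lebesgueOn Ω))
        atTop (𝓝 (∫ x, f x ∂ν))) :
    ∃ M : ℝ, ∀ (s : Finset ℕ) (K : ℕ → Set Ω), (∀ i, IsCompact (K i)) →
      Pairwise (Function.onFun Disjoint K) →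
      ∑ i ∈ s, ν (K i) ^ ((n : ℝ) / ((n : ℝ) - 1))⁻¹ ≤ ENNReal.ofReal M := by
  have hn1 : (1 : ℝ) < n := by exact_mod_cast hn
  set p : ℝ := (n : ℝ) / ((n : ℝ) - 1) with hp
  have hp0 : 0 < p := div_pos (by linarith) (by linarith)
  have hpi : 0 ≤ p⁻¹ := inv_nonneg.2 hp0.le
  obtain ⟨C, hC0, hC⟩ := exists_rpow_integral_cutoff_le hn
  choose M hM using hu.exists_norm_toZeroAtInftyDual_le
  refine ⟨C * ∑ i, ∑ j, M i j, fun s K hK hd => ?_⟩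
  obtain ⟨φ, hφ1, hφ01, hφd⟩ := TestFunction.exists_disjoint_cutoffs s hK hd
  choose L hL0 hL using fun m => (φ m).exists_abs_fderiv_le
  have hsum : ∀ k, ∑ m ∈ s, (∫ x : Ω, φ m x ^ p *
      ‖(u k : Ω →₁[lebesgueOn Ω] EuclideanSpace ℝ (Fin n)) x‖ ^ p ∂(lebesgueOn Ω)) ^ p⁻¹ ≤
      C * ((∑ i, ∑ j, M i j) + (∑ m ∈ s, L m) *
        ‖(u k : Ω →₁[lebesgueOn Ω] EuclideanSpace ℝ (Fin n))‖) := by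
    intro k
    refine (Finset.sum_le_sum fun m _ => hC Ω (u k) (BD.symGradient (u k)) (u k).2.choose_spec (φ m)
      (fun x => (hφ01 m x).1) (L m) (hL m)).trans ?_
    rw [← Finset.mul_sum]
    refine mul_le_mul_of_nonneg_left ?_ hC0
    simp only [cutoffMass]
    rw [Finset.sum_add_distrib, ← Finset.sum_mul, Finset.sum_comm]
    refine add_le_add_left (Finset.sum_le_sum fun i _ => ?_) _
    rw [Finset.sum_comm]
    refine Finset.sum_le_sum fun j _ => ?_
    refine (sum_norm_comp_mulLeftCLM_le _ s (fun m => (φ m).toZeroAtInfty) (fun m _ x => ?_)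
      fun m hm l hl hml x => hφd m hm l hl hml x).trans (hM i j k)
    rw [TestFunction.toZeroAtInfty_apply, abs_of_nonneg (hφ01 m x).1]
    exact (hφ01 m x).2
  have hlimL : Tendsto (fun k => ∑ m ∈ s, (∫ x : Ω, φ m x ^ p *
      ‖(u k : Ω →₁[lebesgueOn Ω] EuclideanSpace ℝ (Fin n)) x‖ ^ p ∂(lebesgueOn Ω)) ^ p⁻¹) atTop
      (𝓝 (∑ m ∈ s, (∫ x : Ω, φ m x ^ p ∂ν) ^ p⁻¹)) :=
    tendsto_finsetSum s fun m _ =>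
      (hν ((φ m).rpowZeroAtInfty hp0)).rpow_const (Or.inr hpi)
  -- The cutoffs, hence `L m`, are fixed while `k → ∞`, so strong `L¹` convergence to zero removes
  -- the gradient terms and the limit no longer depends on the family.
  have hlimR : Tendsto (fun k => C * ((∑ i, ∑ j, M i j) + (∑ m ∈ s, L m) *
        ‖(u k : Ω →₁[lebesgueOn Ω] EuclideanSpace ℝ (Fin n))‖)) atTop
      (𝓝 (C * ∑ i, ∑ j, M i j)) := by
    have h := (((hu.1.norm).const_mul (∑ m ∈ s, L m)).const_add (∑ i, ∑ j, M i j)).const_mul C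
    simpa using h
  have hlim := le_of_tendsto_of_tendsto' hlimL hlimR hsum
  have hint0 : ∀ m, 0 ≤ ∫ x : Ω, φ m x ^ p ∂ν := fun m =>
    integral_nonneg fun x => Real.rpow_nonneg (hφ01 m x).1 _
  have hνK : ∀ m, ν (K m) ≤ ENNReal.ofReal (∫ x : Ω, φ m x ^ p ∂ν) := by
    intro m
    have hi : Integrable (fun x : Ω => φ m x ^ p) ν :=
      BoundedContinuousFunction.integrable ν ((φ m).rpowZeroAtInfty hp0).toBCF
    rw [ofReal_integral_eq_lintegral_ofReal hi
      (ae_of_all _ fun x => Real.rpow_nonneg (hφ01 m x).1 _),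
      ← lintegral_indicator_one (hK m).isClosed.measurableSet]
    refine lintegral_mono fun x => ?_
    by_cases hx : x ∈ K m
    · simp [hx, hφ1 m x hx]
    · simp [hx]
  calc ∑ m ∈ s, ν (K m) ^ p⁻¹
      ≤ ∑ m ∈ s, ENNReal.ofReal ((∫ x : Ω, φ m x ^ p ∂ν) ^ p⁻¹) := by
        refine Finset.sum_le_sum fun m _ => ?_
        rw [← ENNReal.ofReal_rpow_of_nonneg (hint0 m) hpi]
        exact ENNReal.rpow_le_rpow (hνK m) hpi
    _ = ENNReal.ofReal (∑ m ∈ s, (∫ x : Ω, φ m x ^ p ∂ν) ^ p⁻¹) :=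
        (ENNReal.ofReal_sum_of_nonneg fun m _ => Real.rpow_nonneg (hint0 m) _).symm
    _ ≤ _ := ENNReal.ofReal_le_ofReal hlim

end Concentration

theorem theorem3p3 {n : ℕ} (hn : 2 ≤ n) (Ω : Opens (EuclideanSpace ℝ (Fin n)))
    (hΩ : Bornology.IsBounded (Ω : Set (EuclideanSpace ℝ (Fin n))))
    (hΩ' : HasLipschitzBoundary (Ω : Set (EuclideanSpace ℝ (Fin n))))
    (u : ℕ → BD Ω) (hu : BD.WeakStarTendsto u ⟨0, BD.zero_mem Ω⟩)
    (ν : Measure Ω) [IsFiniteMeasure ν]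
    (hν : ∀ f : C₀(Ω, ℝ),
      Tendsto (fun k => ∫ x : Ω, f x *
          ‖(u k : Ω →₁[lebesgueOn Ω] EuclideanSpace ℝ (Fin n)) x‖ ^ ((n : ℝ) / ((n : ℝ) - 1))
          ∂(lebesgueOn Ω))
        atTop (𝓝 (∫ x, f x ∂ν))) :
    ∃ D : Set Ω, D.Countable ∧ ∃ c : D → ℝ, (∀ x, 0 < c x) ∧
      ν = Measure.sum fun x : D => ENNReal.ofReal (c x) • Measure.dirac (x : Ω) := by
  obtain ⟨M, hM⟩ := exists_sum_rpow_measure_le hn hu ν hν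
  have hn1 : (1 : ℝ) < n := by exact_mod_cast hn
  have hp1 : 1 < (n : ℝ) / ((n : ℝ) - 1) := by
    rw [one_lt_div (by linarith)]
    linarith
  have : LocallyCompactSpace Ω := Ω.isOpen.locallyCompactSpace
  -- The exponent is `θ = (n - 1) / n`, strictly between 0 and 1.
  have hatoms := measure_setOf_singleton_eq_zero_of_sum_rpow_le ν
    (inv_pos.2 (zero_lt_one.trans hp1)) (inv_lt_one_of_one_lt₀ hp1) ENNReal.ofReal_ne_top hM
  have hD : {x | ν {x} ≠ 0}.Countable := ν.countable_setOf_measure_singleton_ne_zero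
  refine ⟨{x | ν {x} ≠ 0}, hD, fun x => ν.real {(x : Ω)}, fun x => ?_,
    ν.eq_sum_dirac_of_measure_compl_eq_zero hD ?_⟩
  · exact ENNReal.toReal_pos x.2 (measure_ne_top ν _)
  · have h : {x | ν {x} ≠ 0}ᶜ = {x | ν {x} = 0} := by ext x; simp
    rw [h, hatoms]
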